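/- Let $H_1,H_2$ be infinite-dimensional separable complex Hilbert spaces, and let $H_1\oplus H_2$ be their Hilbert space direct sum. For Hilbert spaces $H,K$, let $\mathcal B(H,K)$ denote the space of bounded linear operators from $H$ to $K$ with the operator norm, and write $\mathcal B(H)=\mathcal B(H,H)$. An operator $S\in\mathcal B(H,K)$ is called norm attaining if there is $x\in H$ with $\|x\|=1$ and $\|Sx\|=\|S\|$; it is called absolutely norm attaining if for every nonzero closed subspace $M\subseteq H$ the restriction $S|_M\in\mathcal B(M,K)$ is norm attaining. Let $\mathcal{AN}(H)\subseteq\mathcal B(H)$ be the set of absolutely norm attaining operators on $H$ and $\overline{\mathcal{AN}(H)}$ its closure in the operator norm. An operator $S\in\mathcal B(H)$ is called Fredholm if its range is closed and $\ker S$ and $\ker S^*$ are finite dimensional, and $\sigma_{\mathrm{ess}}(S)=\{\mu\in\mathbb C: S-\mu I\text{ is not Fredholm}\}$. An operator $S \in \mathcal B(H)$ is called positive if $\langle Sx,x\rangle\ge 0$ for all $x\in H$. Theorem. Let $A_1\in\mathcal B(H_1)$ and $A_2\in\mathcal B(H_2)$ be positive, let $X\in\mathcal B(H_2,H_1)$,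 and suppose that the block operator $$T=\begin{bmatrix}A_1&X\\X^*&A_2\end{bmatrix}\in\mathcal B(H_1\oplus H_2)$$ is positive. Then $T\in\overline{\mathcal{AN}(H_1\oplus H_2)}$ if and only if all of the following hold: $A_j\in\overline{\mathcal{AN}(H_j)}$ for $j=1,2$; $\sigma_{\mathrm{ess}}(A_1)=\sigma_{\mathrm{ess}}(A_2)$; and $X$ is a compact operator. -/

import Mathlib

noncomputable section

namespace AbsNorm

open ContinuousLinearMap

section General

variable {H₁ H₂ : Type*}
  [NormedAddCommGroup H₁] [InnerProductSpace ℂ H₁]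
  [NormedAddCommGroup H₂] [InnerProductSpace ℂ H₂]

/-- `T` is norm attaining: `‖T x‖ = ‖T‖` for some unit vector `x`. -/
def NormAttaining (T : H₁ →L[ℂ] H₂) : Prop :=
  ∃ x : H₁, ‖x‖ = 1 ∧ ‖T x‖ = ‖T‖

/-- `T` is absolutely norm attaining: its restriction to every nonzero closed subspace is
norm attaining. -/
def AbsolutelyNormAttaining (T : H₁ →L[ℂ] H₂) : Prop :=
  ∀ M : Submodule ℂ H₁, IsClosed (M : Set H₁) → M ≠ ⊥ → NormAttaining (T ∘L M.subtypeL)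

variable (H₁ H₂) in
/-- The class `𝒜𝒩(H₁, H₂)` of absolutely norm attaining operators. -/
def AN : Set (H₁ →L[ℂ] H₂) := {T | AbsolutelyNormAttaining T}

/-- The essential spectrum: all `μ ∈ ℂ` for which `T - μ I` is not Fredholm. -/
def essentialSpectrum (T : H₁ →L[ℂ] H₁) : Set ℂ :=
  {μ | ¬ (T - μ • ContinuousLinearMap.id ℂ H₁).IsFredholm}

/-- The block operator `[[A₁₁, A₁₂], [A₂₁, A₂₂]]` on the Hilbert space direct sum `H₁ ⊕ H₂`. -/
def blockOperator (A₁₁ : H₁ →L[ℂ] H₁) (A₁₂ : H₂ →L[ℂ] H₁) (A₂₁ : H₁ →L[ℂ] H₂)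
    (A₂₂ : H₂ →L[ℂ] H₂) : WithLp 2 (H₁ × H₂) →L[ℂ] WithLp 2 (H₁ × H₂) :=
  (WithLp.prodContinuousLinearEquiv 2 ℂ H₁ H₂).symm.toContinuousLinearMap ∘L
    ((A₁₁.coprod A₁₂).prod (A₂₁.coprod A₂₂)) ∘L
      (WithLp.prodContinuousLinearEquiv 2 ℂ H₁ H₂).toContinuousLinearMap

theorem blockOperator_apply (A₁₁ : H₁ →L[ℂ] H₁) (A₁₂ : H₂ →L[ℂ] H₁) (A₂₁ : H₁ →L[ℂ] H₂)
    (A₂₂ : H₂ →L[ℂ] H₂) (x : H₁) (y : H₂) :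
    blockOperator A₁₁ A₁₂ A₂₁ A₂₂ (WithLp.toLp 2 (x, y)) =
      WithLp.toLp 2 (A₁₁ x + A₁₂ y, A₂₁ x + A₂₂ y) := rfl

end General

/-- For operators between Hilbert spaces, being Fredholm means that the range is closed and the
kernels of the operator and of its adjoint are finite dimensional. -/
theorem isFredholm_iff {H₁ H₂ : Type*}
    [NormedAddCommGroup H₁] [InnerProductSpace ℂ H₁] [CompleteSpace H₁]
    [NormedAddCommGroup H₂] [InnerProductSpace ℂ H₂] [CompleteSpace H₂] (T : H₁ →L[ℂ] H₂) :
    T.IsFredholm ↔ IsClosed (Set.range T) ∧ FiniteDimensional ℂ T.ker ∧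
      FiniteDimensional ℂ (adjoint T).ker := by
  have key : IsClosed (T.range : Set H₂) →
      (T.range.CoFG ↔ FiniteDimensional ℂ (adjoint T).ker) := by
    intro hc
    have : CompleteSpace T.range := hc.completeSpace_coe
    rw [← orthogonal_range]
    have hcompl := Submodule.isCompl_orthogonal (K := T.range)
    have e := T.range.quotientEquivOfIsCompl _ hcompl
    constructor
    · intro h
      have : Module.Finite ℂ (H₂ ⧸ T.range) := h
      exact Module.Finite.equiv e
    · intro h
      exact Module.Finite.equiv e.symm
  constructor
  · rintro ⟨-, hc, hk, hco, -⟩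
    exact ⟨hc, hk, (key hc).1 hco⟩
  · rintro ⟨hc, hk, hco⟩
    have hc' : IsClosed (T.range : Set H₂) := hc
    refine ⟨?_, hc', hk, (key hc').2 hco, ?_⟩
    · have : CompleteSpace T.range := hc'.completeSpace_coe
      exact (T.rangeRestrict.isQuotientMap (LinearMap.surjective_rangeRestrict T.toLinearMap))
    · exact Submodule.ClosedComplemented.of_finiteDimensional _

end AbsNorm

end

/-!
A positive operator `T` on an infinite-dimensional Hilbert space is a norm limit of absolutely norm
attaining operators if and only if `T - c` is compact for some scalar `c`
(`AbsNorm.IsPositive.mem_closure_AN_iff`). This turns the theorem into a statement about compact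
operators: a block operator is compact exactly when its four entries are
(`AbsNorm.isCompactOperator_blockOperator_iff`), `X*` is compact when `X` is, and the essential
spectrum of `c + compact` is `{c}` (`AbsNorm.essentialSpectrum_eq_singleton`), so that equality of
the essential spectra says that the two diagonal entries have the same scalar part.

For the characterization, one direction approximates the compact part by operators `F` of finite
rank: `c + F` is absolutely norm attaining, because on each closed subspace it is a multiple of an
isometry up to a finite-dimensional orthogonal summand
(`AbsNorm.smul_id_add_mem_AN_of_hasFiniteRange`).

In the other direction, let `S` be absolutely norm attaining. If the values of `‖S x‖²` on unit
vectors orthogonal to a finite-dimensional subspace did not concentrate at one point as the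
subspace grows, there would be an orthonormal sequence mapped by `S` to an orthogonal sequence of
strictly increasing norms, and `S` would not attain its norm on the closed span of the sequence.
Hence they concentrate at some `c`, which means that `S* S - c` is compact
(`AbsNorm.AbsolutelyNormAttaining.exists_isCompactOperator_adjoint_comp_self_sub`). The
operators that are scalar modulo compact operators form a closed set, so `T²` is one of them for every `T` in the closure,
and for positive `T` the factorization `T² - γ² = (T - γ) (T + γ)` gives the same for `T`.
-/

namespace AbsNorm

open ContinuousLinearMap
open scoped InnerProductSpace

/-! ### Compact operators between Hilbert spaces -/

section Compact

variable {H K : Type*}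
  [NormedAddCommGroup H] [InnerProductSpace ℂ H]
  [NormedAddCommGroup K] [InnerProductSpace ℂ K]

theorem isCompactOperator_of_hasFiniteRange {F : H →L[ℂ] K}
    (hF : F.toLinearMap.HasFiniteRange) : IsCompactOperator F := by
  have : FiniteDimensional ℂ F.range := Module.Finite.of_fg hF
  have : LocallyCompactSpace F.range := .of_finiteDimensional_of_complete ℂ _
  exact (isCompactOperator_of_locallyCompactSpace_dom F.rangeRestrict).clm_comp F.range.subtypeL

theorem hasFiniteRange_starProjection_comp (L : Submodule ℂ K) [FiniteDimensional ℂ L]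
    (A : H →L[ℂ] K) : (L.starProjection ∘L A).toLinearMap.HasFiniteRange := by
  have h : (L.orthogonalProjectionOnto ∘L A).toLinearMap.HasFiniteRange := by simp
  exact h.comp_left L.subtype

theorem hasFiniteRange_comp_starProjection (L : Submodule ℂ H) [FiniteDimensional ℂ L]
    (A : H →L[ℂ] K) : (A ∘L L.starProjection).toLinearMap.HasFiniteRange := by
  have h : L.orthogonalProjectionOnto.toLinearMap.HasFiniteRange := by simp
  exact h.comp_left (A ∘L L.subtypeL).toLinearMap

/-- A compact operator is approximated in norm by its compositions with finite-rank orthogonal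
projections: project onto the span of a finite `ε`-net of the image of the unit ball. -/
theorem exists_norm_sub_starProjection_comp_le {A : H →L[ℂ] K} (hA : IsCompactOperator A)
    {ε : ℝ} (hε : 0 < ε) :
    ∃ (L : Submodule ℂ K) (_ : FiniteDimensional ℂ L), ‖A - L.starProjection ∘L A‖ ≤ ε := by
  have hc : TotallyBounded (A '' Metric.closedBall 0 1) :=
    (IsCompactOperator.isCompact_closure_image_closedBall (f := A.toLinearMap) hA
      1).totallyBounded.subset subset_closure
  obtain ⟨t, ht, hcov⟩ := Metric.totallyBounded_iff.1 hc ε hε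
  have hfd : FiniteDimensional ℂ (Submodule.span ℂ t) := FiniteDimensional.span_of_finite ℂ ht
  refine ⟨Submodule.span ℂ t, hfd, ?_⟩
  refine opNorm_le_of_unit_norm hε.le fun x hx ↦ ?_
  have hx' : A x ∈ A '' Metric.closedBall 0 1 := ⟨x, by simp [hx], rfl⟩
  obtain ⟨y, hy, hxy⟩ := Set.mem_iUnion₂.1 (hcov hx')
  calc ‖(A - (Submodule.span ℂ t).starProjection ∘L A) x‖
      = ‖A x - (Submodule.span ℂ t).starProjection (A x)‖ := rfl
    _ = ⨅ z : Submodule.span ℂ t, ‖A x - z‖ := Submodule.starProjection_minimal _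
    _ ≤ ‖A x - y‖ :=
        ciInf_le ⟨0, by rintro _ ⟨z, rfl⟩; positivity⟩
          (⟨y, Submodule.subset_span hy⟩ : Submodule.span ℂ t)
    _ ≤ ε := by rw [← dist_eq_norm]; exact (Metric.mem_ball.1 hxy).le

variable [CompleteSpace K]

theorem isCompactOperator_of_forall_norm_sub_le {A : H →L[ℂ] K}
    (h : ∀ ε : ℝ, 0 < ε → ∃ B : H →L[ℂ] K, IsCompactOperator B ∧ ‖A - B‖ ≤ ε) :
    IsCompactOperator A := by
  have : A ∈ closure {B : H →L[ℂ] K | IsCompactOperator B} := by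
    refine Metric.mem_closure_iff.2 fun ε hε ↦ ?_
    obtain ⟨B, hB, hAB⟩ := h (ε / 2) (by positivity)
    exact ⟨B, hB, by rw [dist_eq_norm]; linarith⟩
  rwa [isClosed_setOfPred_isCompactOperator.closure_eq] at this

variable [CompleteSpace H]

/-- If `A* A` is compact, so is `A`: for a finite-rank projection `Q` almost fixing `A* A`,
`‖A (1 - Q)‖² = ‖(1 - Q) A* A (1 - Q)‖` is small. -/
theorem isCompactOperator_of_adjoint_comp_self {A : H →L[ℂ] K}
    (h : IsCompactOperator (adjoint A ∘L A)) : IsCompactOperator A := by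
  refine isCompactOperator_of_forall_norm_sub_le fun ε hε ↦ ?_
  obtain ⟨L, hL, hLε⟩ := exists_norm_sub_starProjection_comp_le h (ε := ε ^ 2) (by positivity)
  refine ⟨A ∘L L.starProjection, isCompactOperator_of_hasFiniteRange
    (hasFiniteRange_comp_starProjection L A), ?_⟩
  have h1 : A - A ∘L L.starProjection = A ∘L Lᗮ.starProjection := by
    ext x; simp [Submodule.starProjection_orthogonal']
  have hsa : adjoint Lᗮ.starProjection = Lᗮ.starProjection :=
    isSelfAdjoint_iff'.1 (isSelfAdjoint_starProjection _)
  have h2 : adjoint (A ∘L Lᗮ.starProjection) ∘L (A ∘L Lᗮ.starProjection) =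
      (adjoint A ∘L A - L.starProjection ∘L (adjoint A ∘L A)) ∘L Lᗮ.starProjection := by
    rw [adjoint_comp, hsa]
    ext x; simp [Submodule.starProjection_orthogonal']
  have h3 := norm_adjoint_comp_self (A ∘L Lᗮ.starProjection)
  rw [h2] at h3
  have h4 : ‖(adjoint A ∘L A - L.starProjection ∘L (adjoint A ∘L A)) ∘L Lᗮ.starProjection‖
      ≤ ε ^ 2 * 1 :=
    (opNorm_comp_le _ _).trans
      (mul_le_mul hLε (Submodule.starProjection_norm_le _) (norm_nonneg _) (by positivity))
  rw [h1]
  exact abs_le_of_sq_le_sq' (by nlinarith) hε.le |>.2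

/-- Schauder's theorem for Hilbert spaces. -/
theorem isCompactOperator_adjoint {A : H →L[ℂ] K} (h : IsCompactOperator A) :
    IsCompactOperator (adjoint A) := by
  refine isCompactOperator_of_adjoint_comp_self ?_
  rw [adjoint_adjoint]
  exact h.comp_clm (adjoint A)

end Compact

/-! ### The essential spectrum of a compact perturbation of a scalar -/

section EssentialSpectrum

variable {H : Type*} [NormedAddCommGroup H] [InnerProductSpace ℂ H]

/-- A quasi-inverse of a compact Fredholm operator exhibits the identity as a compact operator. -/
theorem finiteDimensional_of_isFredholm_of_isCompactOperator {A : H →L[ℂ] H}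
    (hA : IsCompactOperator A) (hF : A.IsFredholm) : FiniteDimensional ℂ H := by
  obtain ⟨v, hv, -⟩ := hF.exists_isQuasiInverse
  have h := LinearMap.FiniteRangeSetoid.equiv_iff_hasFiniteRange.1 hv
  have h1 : IsCompactOperator (v ∘L A - ContinuousLinearMap.id ℂ H) :=
    isCompactOperator_of_hasFiniteRange h
  have h2 : IsCompactOperator (v ∘L A) := hA.clm_comp v
  have h3 := h2.sub h1
  refine FiniteDimensional.of_isCompactOperator_id (𝕜 := ℂ) (E := H) ?_
  have h4 : (id : H → H) = ⇑(v ∘L A) - ⇑(v ∘L A - ContinuousLinearMap.id ℂ H) := by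
    funext x
    simp
  rwa [h4]

variable [CompleteSpace H]

/-- A compact perturbation of a nonzero scalar is Fredholm: up to a finite-rank term it is a small
perturbation of the scalar, hence invertible, and the inverse serves as a quasi-inverse. -/
theorem isFredholm_smul_id_add_of_isCompactOperator {A : H →L[ℂ] H} (hA : IsCompactOperator A)
    {c : ℂ} (hc : c ≠ 0) : (c • ContinuousLinearMap.id ℂ H + A).IsFredholm := by
  obtain ⟨L, hL, hLε⟩ := exists_norm_sub_starProjection_comp_le hA (ε := ‖c‖ / 2) (by positivity)
  set F := L.starProjection ∘L A
  have hF : F.toLinearMap.HasFiniteRange := hasFiniteRange_starProjection_comp L A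
  have hsmall : ‖-(c⁻¹ • (A - F))‖ < 1 := by
    rw [norm_neg, norm_smul, norm_inv]
    have : ‖c‖⁻¹ * ‖A - F‖ ≤ ‖c‖⁻¹ * (‖c‖ / 2) := by gcongr
    have h2 : ‖c‖⁻¹ * (‖c‖ / 2) = 1 / 2 := by field_simp
    linarith
  obtain ⟨u, hu⟩ := (isUnit_one_sub_of_norm_lt_one hsmall).smul (Units.mk0 c hc)
  have hu' : c • ContinuousLinearMap.id ℂ H + A = u + F := by
    rw [hu]
    ext x
    simp [Units.smul_def, smul_smul, hc]
    abel
  rw [hu']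
  refine IsFredholm.of_isQuasiInverse (v := (↑u⁻¹ : H →L[ℂ] H)) ⟨?_, ?_⟩
  · refine LinearMap.FiniteRangeSetoid.equiv_iff_hasFiniteRange.2 ?_
    have : (↑u⁻¹ : H →L[ℂ] H).toLinearMap ∘ₗ (↑u + F : H →L[ℂ] H).toLinearMap - .id =
        (↑u⁻¹ : H →L[ℂ] H).toLinearMap ∘ₗ F.toLinearMap := by
      ext x
      have : (↑u⁻¹ : H →L[ℂ] H) ((↑u : H →L[ℂ] H) x) = x := DFunLike.congr_fun u.inv_mul x
      simp [this]
    rw [this]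
    exact hF.comp_left _
  · refine LinearMap.FiniteRangeSetoid.equiv_iff_hasFiniteRange.2 ?_
    have : (↑u + F : H →L[ℂ] H).toLinearMap ∘ₗ (↑u⁻¹ : H →L[ℂ] H).toLinearMap - .id =
        F.toLinearMap ∘ₗ (↑u⁻¹ : H →L[ℂ] H).toLinearMap := by
      ext x
      have : (↑u : H →L[ℂ] H) ((↑u⁻¹ : H →L[ℂ] H) x) = x := DFunLike.congr_fun u.mul_inv x
      simp [this]
    rw [this]
    exact hF.comp_right _

/-- On an infinite-dimensional space, the essential spectrum of a compact perturbation of the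
scalar `c` is `{c}`. -/
theorem essentialSpectrum_eq_singleton (hH : ¬ FiniteDimensional ℂ H) {A : H →L[ℂ] H} {c : ℂ}
    (hA : IsCompactOperator (A - c • ContinuousLinearMap.id ℂ H)) :
    essentialSpectrum A = {c} := by
  ext μ
  simp only [essentialSpectrum, Set.mem_ofPred_eq, Set.mem_singleton_iff]
  constructor
  · intro h
    by_contra hμ
    apply h
    have := isFredholm_smul_id_add_of_isCompactOperator hA (c := c - μ)
      (sub_ne_zero.2 (Ne.symm hμ))
    convert this using 1
    ext x
    simp [sub_smul]
  · rintro rfl h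
    exact hH (finiteDimensional_of_isFredholm_of_isCompactOperator hA h)

end EssentialSpectrum

/-! ### Finite-rank perturbations of scalars are absolutely norm attaining -/

section FiniteRankPerturbation

/-- If `S` acts as a multiple of an isometry on a subspace `N` of finite codimension and maps `N`
and `Nᗮ` to orthogonal subspaces, then the norm of `S` is attained on a finite-dimensional space,
spanned by `Nᗮ` and one unit vector of `N`. -/
theorem normAttaining_of_finiteDimensional_orthogonal {E K : Type*}
    [NormedAddCommGroup E] [InnerProductSpace ℂ E] [Nontrivial E]
    [NormedAddCommGroup K] [InnerProductSpace ℂ K]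
    (S : E →L[ℂ] K) (N : Submodule ℂ E) [N.HasOrthogonalProjection] [FiniteDimensional ℂ Nᗮ]
    (r : ℝ) (hN : ∀ x ∈ N, ‖S x‖ = r * ‖x‖) (hort : ∀ x ∈ N, ∀ y ∈ Nᗮ, ⟪S x, S y⟫_ℂ = 0) :
    NormAttaining S := by
  obtain ⟨L, hLfd, hLne, hL, hLN⟩ : ∃ L : Submodule ℂ E, FiniteDimensional ℂ L ∧ Nontrivial L ∧
      Nᗮ ≤ L ∧ (N = ⊥ ∨ ∃ x ∈ N, x ∈ L ∧ ‖x‖ = 1) := by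
    by_cases h : N = ⊥
    · refine ⟨Nᗮ, inferInstance, ?_, le_rfl, .inl h⟩
      rw [h, Submodule.bot_orthogonal_eq_top]
      exact Submodule.nontrivial_iff_ne_bot.2 top_ne_bot
    · obtain ⟨x, hx, hx0⟩ := N.ne_bot_iff.1 h
      have hxn : ‖x‖ ≠ 0 := norm_ne_zero_iff.2 hx0
      refine ⟨Nᗮ ⊔ ℂ ∙ x, inferInstance, ?_, le_sup_left, .inr ⟨((‖x‖⁻¹ : ℝ) : ℂ) • x,
        N.smul_mem _ hx, ?_, ?_⟩⟩
      · exact Submodule.nontrivial_iff_ne_bot.2 ((Submodule.ne_bot_iff _).2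
          ⟨x, Submodule.mem_sup_right (Submodule.mem_span_singleton_self x), hx0⟩)
      · exact Submodule.smul_mem _ _
          (Submodule.mem_sup_right (Submodule.mem_span_singleton_self x))
      · rw [norm_smul]; simp [hxn]
  have : ProperSpace L := FiniteDimensional.proper ℂ L
  obtain ⟨x₀, hx₀, hmax⟩ := (isCompact_sphere (0 : L) 1).exists_isMaxOn
    (Set.nonempty_coe_sort.1 (NormedSpace.sphere_nonempty_rclike ℂ zero_le_one))
    (f := fun x : L ↦ ‖S x‖) (by fun_prop)
  have hx₀' : ‖(x₀ : E)‖ = 1 := by simpa using hx₀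
  have hbound : ∀ y ∈ L, ‖S y‖ ≤ ‖S x₀‖ * ‖y‖ := by
    intro y hy
    by_cases hy0 : y = 0
    · simp [hy0]
    have hyn : ‖y‖ ≠ 0 := norm_ne_zero_iff.2 hy0
    have h := hmax (show ((‖y‖⁻¹ : ℝ) : ℂ) • (⟨y, hy⟩ : L) ∈ Metric.sphere 0 1 by
      simp [norm_smul, hyn])
    simp only [Submodule.coe_smul, map_smul, norm_smul, Set.mem_ofPred_eq] at h
    rw [Complex.norm_real, norm_inv, norm_norm, inv_mul_le_iff₀ (by positivity)] at h
    linarith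
  refine ⟨x₀, hx₀', le_antisymm (by simpa [hx₀'] using S.le_opNorm x₀) ?_⟩
  refine S.opNorm_le_bound (norm_nonneg _) fun x ↦ ?_
  set n := N.starProjection x
  set m := x - n
  have hn : n ∈ N := N.starProjection_apply_mem x
  have hm : m ∈ Nᗮ := N.sub_starProjection_mem_orthogonal x
  have hx : x = n + m := by simp [m]
  have hSn : ‖S n‖ ≤ ‖S x₀‖ * ‖n‖ := by
    rcases hLN with h | ⟨z, hzN, hzL, hz⟩
    · have : n = 0 := by simpa [h] using hn
      simp [this]
    · have h1 := hbound z hzL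
      rw [hN z hzN, hz, mul_one, mul_one] at h1
      rw [hN n hn]
      gcongr
  have hSm := hbound m (hL hm)
  have h1 : ‖S x‖ * ‖S x‖ = ‖S n‖ * ‖S n‖ + ‖S m‖ * ‖S m‖ := by
    rw [hx, map_add]
    exact norm_add_sq_eq_norm_sq_add_norm_sq_of_inner_eq_zero _ _ (hort n hn m hm)
  have h2 : ‖x‖ * ‖x‖ = ‖n‖ * ‖n‖ + ‖m‖ * ‖m‖ := by
    rw [hx]
    exact norm_add_sq_eq_norm_sq_add_norm_sq_of_inner_eq_zero _ _
      (Submodule.inner_right_of_mem_orthogonal hn hm)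
  have h3 : ‖S x‖ ^ 2 ≤ (‖S x₀‖ * ‖x‖) ^ 2 := by
    have a1 := mul_self_le_mul_self (norm_nonneg _) hSn
    have a2 := mul_self_le_mul_self (norm_nonneg _) hSm
    calc ‖S x‖ ^ 2 = ‖S n‖ * ‖S n‖ + ‖S m‖ * ‖S m‖ := by rw [sq, h1]
      _ ≤ ‖S x₀‖ * ‖n‖ * (‖S x₀‖ * ‖n‖) + ‖S x₀‖ * ‖m‖ * (‖S x₀‖ * ‖m‖) := add_le_add a1 a2
      _ = ‖S x₀‖ ^ 2 * (‖n‖ * ‖n‖ + ‖m‖ * ‖m‖) := by ring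
      _ = (‖S x₀‖ * ‖x‖) ^ 2 := by rw [← h2]; ring
  exact le_of_sq_le_sq h3 (by positivity)

variable {H : Type*} [NormedAddCommGroup H] [InnerProductSpace ℂ H] [CompleteSpace H]

theorem smul_id_add_mem_AN_of_hasFiniteRange (c : ℂ) {F : H →L[ℂ] H}
    (hF : F.toLinearMap.HasFiniteRange) : c • ContinuousLinearMap.id ℂ H + F ∈ AN H H := by
  intro M hMc hM
  have : CompleteSpace M := hMc.completeSpace_coe
  have : Nontrivial M := Submodule.nontrivial_iff_ne_bot.2 hM
  -- `N` consists of the `x ∈ M` with `F x = 0` and `x ⟂ F M`. There the operator is the scalar `c`,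
  -- and it maps `N` and its complement in `M` to orthogonal subspaces.
  set F₁ : M →L[ℂ] H := F ∘L M.subtypeL
  have hF₁ : F₁.toLinearMap.HasFiniteRange := hF.comp_right M.subtype
  set R := (M.orthogonalProjectionOnto ∘L F₁).range
  have hRfd : FiniteDimensional ℂ R :=
    Module.Finite.of_fg (hF₁.comp_left M.orthogonalProjectionOnto.toLinearMap)
  have hkfd : FiniteDimensional ℂ F₁.kerᗮ :=
    Module.Finite.of_fg (Submodule.CoFG.fg_of_disjoint
      (Submodule.orthogonal_disjoint F₁.ker).symm hF₁.cofg_ker)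
  set L := F₁.kerᗮ ⊔ R
  have hLL : FiniteDimensional ℂ Lᗮᗮ := by rw [Submodule.orthogonal_orthogonal]; infer_instance
  have hker : ∀ x ∈ Lᗮ, F x = 0 := by
    intro x hx
    have h1 : x ∈ F₁.kerᗮᗮ := Submodule.orthogonal_le le_sup_left hx
    have : CompleteSpace F₁.ker := F₁.isClosed_ker.completeSpace_coe
    rw [Submodule.orthogonal_orthogonal] at h1
    exact h1
  refine normAttaining_of_finiteDimensional_orthogonal _ Lᗮ ‖c‖ ?_ ?_
  · intro x hx
    simp [hker x hx, norm_smul]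
  · intro x hx y hy
    have h1 : ⟪x, y⟫_ℂ = 0 := Submodule.inner_right_of_mem_orthogonal hx hy
    have h2 : ⟪M.orthogonalProjectionOnto (F y), x⟫_ℂ = 0 :=
      Submodule.inner_right_of_mem_orthogonal (K := R) ⟨y, rfl⟩
        (Submodule.orthogonal_le le_sup_right hx)
    rw [Submodule.inner_orthogonalProjectionOnto_eq_of_mem_right, inner_eq_zero_symm] at h2
    simp [hker x hx, h2, ← Submodule.coe_inner, h1]

theorem mem_closure_AN_of_isCompactOperator {A : H →L[ℂ] H} {c : ℂ}
    (hA : IsCompactOperator (A - c • ContinuousLinearMap.id ℂ H)) : A ∈ closure (AN H H) := by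
  refine Metric.mem_closure_iff.2 fun ε hε ↦ ?_
  obtain ⟨L, hL, hLε⟩ := exists_norm_sub_starProjection_comp_le hA (ε := ε / 2) (by positivity)
  refine ⟨_, smul_id_add_mem_AN_of_hasFiniteRange c 
    (hasFiniteRange_starProjection_comp L (A - c • ContinuousLinearMap.id ℂ H)), ?_⟩
  rw [dist_eq_norm, ← sub_sub]
  exact hLε.trans_lt (by linarith)

end FiniteRankPerturbation

/-! ### Absolutely norm attaining operators have scalar modulus up to compact operators -/

section Obstruction

variable {H K : Type*}
  [NormedAddCommGroup H] [InnerProductSpace ℂ H]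
  [NormedAddCommGroup K] [InnerProductSpace ℂ K]

/-- An operator that maps an orthonormal sequence to an orthogonal sequence of strictly increasing
norms does not attain its norm on the closed span of the sequence. -/
theorem not_absolutelyNormAttaining_of_strictMono {S : H →L[ℂ] K} {e : ℕ → H}
    (he : ∀ n, ‖e n‖ = 1) (hort : ∀ m n, m ≠ n → ⟪e m, e n⟫_ℂ = 0)
    (hS : ∀ m n, m ≠ n → ⟪S (e m), S (e n)⟫_ℂ = 0) (hmono : StrictMono fun n ↦ ‖S (e n)‖) :
    ¬ AbsolutelyNormAttaining S := by
  intro hAN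
  set M := (Submodule.span ℂ (Set.range e)).topologicalClosure
  have heM : ∀ n, e n ∈ M := fun n ↦
    Submodule.le_topologicalClosure _ (Submodule.subset_span ⟨n, rfl⟩)
  have hMbot : M ≠ ⊥ := M.ne_bot_iff.2 ⟨e 0, heM 0, norm_ne_zero_iff.1 (by simp [he 0])⟩
  -- Two continuous functionals agreeing on the sequence agree on `M`.
  have hext : ∀ f g : H →L[ℂ] ℂ, (∀ n, f (e n) = g (e n)) → ∀ x ∈ M, f x = g x := by
    intro f g hfg x hx
    have h1 : Submodule.span ℂ (Set.range e) ≤ (f - g).ker := by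
      rw [Submodule.span_le]
      rintro _ ⟨n, rfl⟩
      simp [hfg n]
    have h2 := Submodule.topologicalClosure_minimal _ h1 (f - g).isClosed_ker hx
    simpa [sub_eq_zero] using h2
  obtain ⟨x, hx, hSx⟩ := hAN M (Submodule.isClosed_topologicalClosure _) hMbot
  set N := ‖S ∘L M.subtypeL‖
  have hN : ∀ y ∈ M, ‖S y‖ ≤ N * ‖y‖ := fun y hy ↦ (S ∘L M.subtypeL).le_opNorm ⟨y, hy⟩
  have hlt : ∀ n, ‖S (e n)‖ < N := fun n ↦
    (hmono n.lt_succ_self).trans_le (by simpa [he] using hN _ (heM (n + 1)))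
  -- A unit vector of `M` attaining the norm has no component along any `e k`, since `S` would
  -- act on that component by the smaller factor `‖S (e k)‖`.
  have hzero : ∀ k, ⟪e k, (x : H)⟫_ℂ = 0 := by
    intro k
    set a := ⟪e k, (x : H)⟫_ℂ with ha
    set y := (x : H) - a • e k
    have hyM : y ∈ M := M.sub_mem x.2 (M.smul_mem _ (heM k))
    have hxy : (x : H) = a • e k + y := by simp [y]
    have hey : ⟪e k, y⟫_ℂ = 0 := by
      simp [y, inner_self_eq_norm_sq_to_K, he, ha]
    have hSey : ⟪S (e k), S y⟫_ℂ = 0 := by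
      have := hext ((innerSL ℂ (S (e k))) ∘L S)
        (((‖S (e k)‖ : ℂ) ^ 2) • innerSL ℂ (e k)) (fun n ↦ by
          by_cases h : k = n
          · subst h
            simp [inner_self_eq_norm_sq_to_K, he]
          · simp [hS k n h, hort k n h]) y hyM
      simpa [hey] using this
    have h1 : ‖(x : H)‖ * ‖(x : H)‖ = ‖a • e k‖ * ‖a • e k‖ + ‖y‖ * ‖y‖ := by
      rw [hxy]
      exact norm_add_sq_eq_norm_sq_add_norm_sq_of_inner_eq_zero _ _
        (by rw [inner_smul_left, hey, mul_zero])
    have h2 : ‖S x‖ * ‖S x‖ = ‖S (a • e k)‖ * ‖S (a • e k)‖ + ‖S y‖ * ‖S y‖ := by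
      rw [hxy, map_add]
      exact norm_add_sq_eq_norm_sq_add_norm_sq_of_inner_eq_zero _ _
        (by rw [map_smul, inner_smul_left, hSey, mul_zero])
    have hx1 : ‖(x : H)‖ = 1 := hx
    have hSx1 : ‖S x‖ = N := hSx
    rw [norm_smul, he, hx1] at h1
    rw [map_smul, norm_smul, hSx1] at h2
    have h3 := mul_self_le_mul_self (norm_nonneg _) (hN y hyM)
    have h4 : N ^ 2 * ‖a‖ ^ 2 ≤ ‖S (e k)‖ ^ 2 * ‖a‖ ^ 2 := by nlinarith
    have h5 : ‖S (e k)‖ ^ 2 < N ^ 2 := by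
      have := hlt k
      gcongr
    by_contra h0
    have : 0 < ‖a‖ ^ 2 := by positivity
    exact absurd (lt_of_mul_lt_mul_right (lt_of_le_of_lt h4 (mul_lt_mul_of_pos_right h5 this))
      this.le) (lt_irrefl _)
  have h0 := hext (innerSL ℂ (x : H)) 0 (fun n ↦ by
    simpa using inner_eq_zero_symm.1 (hzero n)) x x.2
  have hx1 : ‖(x : H)‖ = 1 := hx
  simp [inner_self_eq_norm_sq_to_K, hx1] at h0

variable [CompleteSpace H] [CompleteSpace K]

/-- If, on the orthogonal complement of every finite-dimensional subspace, `‖S x‖²` takes values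
below `s` and values above `t` on unit vectors, with `s < t`, then it takes there every
value in between, and an orthonormal sequence as in `not_absolutelyNormAttaining_of_strictMono` is
constructed inductively. -/
theorem not_absolutelyNormAttaining_of_gap {S : H →L[ℂ] K} {s t : ℝ} (hst : s < t)
    (hs : ∀ L : Submodule ℂ H, FiniteDimensional ℂ L → ∃ x ∈ Lᗮ, ‖x‖ = 1 ∧ ‖S x‖ ^ 2 < s)
    (ht : ∀ L : Submodule ℂ H, FiniteDimensional ℂ L → ∃ x ∈ Lᗮ, ‖x‖ = 1 ∧ t < ‖S x‖ ^ 2) :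
    ¬ AbsolutelyNormAttaining S := by
  classical
  obtain ⟨e, he, her⟩ := exists_seq_of_forall_finset_exists
    (fun x : H ↦ ‖x‖ = 1 ∧ ‖S x‖ ^ 2 < t)
    (fun x y ↦ ⟪x, y⟫_ℂ = 0 ∧ ⟪S x, S y⟫_ℂ = 0 ∧ ‖S x‖ ^ 2 < ‖S y‖ ^ 2) (by
      intro A hA
      obtain ⟨l, hl1, hl2⟩ := Order.exists_between_finsets
        (insert s (A.image fun x ↦ ‖S x‖ ^ 2)) {t} (by
          intro x hx y hy
          rw [Finset.mem_singleton] at hy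
          subst hy
          rcases Finset.mem_insert.1 hx with rfl | hx
          · exact hst
          · obtain ⟨z, hz, rfl⟩ := Finset.mem_image.1 hx
            exact (hA z hz).2)
      -- Orthogonality of `w` to `S* S x` is orthogonality of `S w` to `S x`.
      set L := Submodule.span ℂ (↑(A ∪ A.image (adjoint S ∘L S)) : Set H)
      have hLfd : FiniteDimensional ℂ L := FiniteDimensional.span_finset ℂ _
      obtain ⟨u, hu, hu1, hus⟩ := hs L hLfd
      obtain ⟨v, hv, hv1, hvt⟩ := ht L hLfd
      have hnt : Nontrivial Lᗮ := Submodule.nontrivial_iff_ne_bot.2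
        ((Submodule.ne_bot_iff _).2 ⟨u, hu, norm_ne_zero_iff.1 (by simp [hu1])⟩)
      have hrank : 1 < Module.rank ℝ Lᗮ := by
        rw [rank_real_of_complex]
        have h1 : (1 : Cardinal) ≤ Module.rank ℂ Lᗮ :=
          Cardinal.one_le_iff_pos.2 rank_pos
        calc (1 : Cardinal) < 2 := by norm_num
          _ = 2 * 1 := by simp
          _ ≤ _ := by gcongr
      have hsl : s < l := hl1 s (by simp)
      have hlt : l < t := hl2 t (by simp)
      obtain ⟨w, hw, hwl⟩ := (isPreconnected_sphere hrank (0 : Lᗮ) 1).intermediate_value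
        (a := ⟨u, hu⟩) (b := ⟨v, hv⟩) (by simpa using hu1) (by simpa using hv1)
        (f := fun x : Lᗮ ↦ ‖S x‖ ^ 2) (by fun_prop)
        (show l ∈ Set.Icc _ _ from ⟨(hus.trans hsl).le, (hlt.trans hvt).le⟩)
      have hwl' : ‖S w‖ ^ 2 = l := hwl
      refine ⟨w, ⟨by simpa using hw, by rw [hwl']; exact hlt⟩, fun x hx ↦ ⟨?_, ?_, ?_⟩⟩
      · exact Submodule.inner_right_of_mem_orthogonal
          (Submodule.subset_span (by simp [hx])) w.2
      · have h : ⟪(adjoint S ∘L S) x, (w : H)⟫_ℂ = 0 :=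
          Submodule.inner_right_of_mem_orthogonal
            (Submodule.subset_span (Finset.mem_coe.2 (Finset.mem_union_right _
              (Finset.mem_image_of_mem _ hx)))) w.2
        rwa [ContinuousLinearMap.comp_apply, adjoint_inner_left] at h
      · rw [hwl']
        exact hl1 _ (Finset.mem_insert_of_mem (Finset.mem_image_of_mem _ hx)))
  refine not_absolutelyNormAttaining_of_strictMono (fun n ↦ (he n).1) (fun m n hmn ↦ ?_)
    (fun m n hmn ↦ ?_) fun m n hmn ↦ lt_of_pow_lt_pow_left₀ 2 (norm_nonneg _) (her m n hmn).2.2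
  · rcases hmn.lt_or_gt with h | h
    · exact (her m n h).1
    · exact inner_eq_zero_symm.1 (her n m h).1
  · rcases hmn.lt_or_gt with h | h
    · exact (her m n h).2.1
    · exact inner_eq_zero_symm.1 (her n m h).2.1

/-- If `‖S x‖²` is within `ε` of `c` for all unit vectors `x ⟂ L`, with `L` finite dimensional, then
`S* S - c` is within `ε` of a finite-rank operator, namely of the difference with its
compression to `Lᗮ`. -/
theorem exists_isCompactOperator_norm_sub_le_of_orthogonal {S : H →L[ℂ] K} {c ε : ℝ}
    (hε : 0 ≤ ε) (L : Submodule ℂ H) [FiniteDimensional ℂ L]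
    (h : ∀ x ∈ Lᗮ, ‖x‖ = 1 → |‖S x‖ ^ 2 - c| ≤ ε) :
    ∃ B : H →L[ℂ] H, IsCompactOperator B ∧
      ‖adjoint S ∘L S - (c : ℂ) • ContinuousLinearMap.id ℂ H - B‖ ≤ ε := by
  set D := adjoint S ∘L S - (c : ℂ) • ContinuousLinearMap.id ℂ H
  set P := Lᗮ.starProjection with hP
  set Q := L.starProjection
  have hDin : ∀ x, RCLike.re ⟪D x, x⟫_ℂ = ‖S x‖ ^ 2 - c * ‖x‖ ^ 2 := by
    intro x
    simp [D, adjoint_inner_left, inner_self_eq_norm_sq_to_K]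
    norm_cast
  have hDsa : IsSelfAdjoint D := by
    refine IsSelfAdjoint.sub (isPositive_adjoint_comp_self S).isSelfAdjoint ?_
    refine IsSelfAdjoint.smul ?_ (.one _)
    simp [isSelfAdjoint_iff]
  have hsymm : (P ∘L D ∘L P).IsSymmetric := by
    intro x y
    simp only [coe_coe, ContinuousLinearMap.comp_apply]
    rw [hP, Submodule.inner_starProjection_left_eq_right,
      ← Submodule.inner_starProjection_left_eq_right _ x]
    exact hDsa.isSymmetric _ _
  refine ⟨D - P ∘L D ∘L P, ?_, ?_⟩
  · have h1 : D - P ∘L D ∘L P = Q ∘L (D ∘L P) + D ∘L Q := by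
      ext x
      simp [P, Q, Submodule.starProjection_orthogonal']
      abel
    rw [h1]
    exact (isCompactOperator_of_hasFiniteRange (hasFiniteRange_starProjection_comp L _)).add
      (isCompactOperator_of_hasFiniteRange (hasFiniteRange_comp_starProjection L _))
  · rw [sub_sub_cancel, norm_eq_iSup_rayleighQuotient _ hsymm]
    refine ciSup_le fun x ↦ ?_
    have hPx : P x ∈ Lᗮ := Submodule.starProjection_apply_mem _ _
    have hkey : |RCLike.re ⟪D (P x), P x⟫_ℂ| ≤ ε * ‖P x‖ ^ 2 := by
      by_cases h0 : P x = 0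
      · simp [h0]
      have hn : ‖P x‖ ≠ 0 := norm_ne_zero_iff.2 h0
      have h2 := h (((‖P x‖⁻¹ : ℝ) : ℂ) • P x) (Submodule.smul_mem _ _ hPx)
        (by simp [norm_smul, hn])
      rw [map_smul, norm_smul, Complex.norm_real, norm_inv, norm_norm] at h2
      have h3 : ‖S (P x)‖ ^ 2 - c * ‖P x‖ ^ 2 =
          ((‖P x‖⁻¹ * ‖S (P x)‖) ^ 2 - c) * ‖P x‖ ^ 2 := by field_simp
      rw [hDin, h3, abs_mul, abs_of_nonneg (sq_nonneg ‖P x‖)]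
      gcongr
    have hle : ‖P x‖ ≤ ‖x‖ := Submodule.norm_starProjection_apply_le _ _
    have hre : (P ∘L D ∘L P).reApplyInnerSelf x = RCLike.re ⟪D (P x), P x⟫_ℂ := by
      rw [reApplyInnerSelf_apply]
      simp only [ContinuousLinearMap.comp_apply]
      rw [hP, Submodule.inner_starProjection_left_eq_right]
    rw [rayleighQuotient, hre, abs_div, abs_of_nonneg (sq_nonneg ‖x‖)]
    refine div_le_of_le_mul₀ (by positivity) hε (hkey.trans ?_)
    gcongr

/-- On an infinite-dimensional space, an absolutely norm attaining operator `S` has `S* S` scalar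
modulo the compact operators. -/
theorem AbsolutelyNormAttaining.exists_isCompactOperator_adjoint_comp_self_sub
    (hH : ¬ FiniteDimensional ℂ H) {S : H →L[ℂ] K} (hS : AbsolutelyNormAttaining S) :
    ∃ c : ℝ, IsCompactOperator (adjoint S ∘L S - (c : ℂ) • ContinuousLinearMap.id ℂ H) := by
  have hunit : ∀ L : Submodule ℂ H, FiniteDimensional ℂ L → ∃ x ∈ Lᗮ, ‖x‖ = 1 := by
    intro L hL
    have hne : Lᗮ ≠ ⊥ := by
      intro h
      rw [Submodule.orthogonal_eq_bot_iff] at h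
      subst h
      exact hH (Module.Finite.of_surjective (⊤ : Submodule ℂ H).subtype
        fun x ↦ ⟨⟨x, trivial⟩, rfl⟩)
    obtain ⟨x, hx, hx0⟩ := Lᗮ.ne_bot_iff.1 hne
    have hxn : ‖x‖ ≠ 0 := norm_ne_zero_iff.2 hx0
    exact ⟨((‖x‖⁻¹ : ℝ) : ℂ) • x, Submodule.smul_mem _ _ hx, by simp [norm_smul, hxn]⟩
  -- `sInf low` is the least value of `‖S x‖²` approached on every `Lᗮ`; absence of a gap makes it
  -- the greatest such value as well.
  set low : Set ℝ := {s | ∀ L : Submodule ℂ H, FiniteDimensional ℂ L →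
    ∃ x ∈ Lᗮ, ‖x‖ = 1 ∧ ‖S x‖ ^ 2 < s} with hlow
  have hne : low.Nonempty := by
    refine ⟨‖S‖ ^ 2 + 1, fun L hL ↦ ?_⟩
    obtain ⟨x, hx, hx1⟩ := hunit L hL
    refine ⟨x, hx, hx1, ?_⟩
    have h1 : ‖S x‖ ≤ ‖S‖ := by simpa [hx1] using S.le_opNorm x
    have : ‖S x‖ ^ 2 ≤ ‖S‖ ^ 2 := by gcongr
    linarith
  have hbdd : BddBelow low := by
    refine ⟨0, fun s hs ↦ ?_⟩
    obtain ⟨x, -, -, hx⟩ := hs ⊥ inferInstance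
    exact (sq_nonneg _).trans hx.le
  refine ⟨sInf low, isCompactOperator_of_forall_norm_sub_le fun ε hε ↦ ?_⟩
  have h1 : sInf low - ε ∉ low := fun h ↦ by linarith [csInf_le hbdd h]
  obtain ⟨s, hs, hsε⟩ := exists_lt_of_csInf_lt hne (show sInf low < sInf low + ε by linarith)
  have h2 : ¬ ∀ L : Submodule ℂ H, FiniteDimensional ℂ L →
      ∃ x ∈ Lᗮ, ‖x‖ = 1 ∧ sInf low + ε < ‖S x‖ ^ 2 := fun h ↦
    not_absolutelyNormAttaining_of_gap hsε hs h hS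
  simp only [hlow, Set.mem_ofPred_eq] at h1
  push Not at h1 h2
  obtain ⟨L₁, hL₁, h1⟩ := h1
  obtain ⟨L₂, hL₂, h2⟩ := h2
  refine exists_isCompactOperator_norm_sub_le_of_orthogonal hε.le (L₁ ⊔ L₂) fun x hx hx1 ↦ ?_
  have a1 := h1 x (Submodule.orthogonal_le le_sup_left hx) hx1
  have a2 := h2 x (Submodule.orthogonal_le le_sup_right hx) hx1
  rw [abs_le]
  constructor <;> linarith

end Obstruction

/-! ### Positive operators in the closure of the absolutely norm attaining operators -/

section Characterization

variable {H : Type*} [NormedAddCommGroup H] [InnerProductSpace ℂ H]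

theorem isCompactOperator_sub_of_sq {T : H →L[ℂ] H} {γ : ℂ} (hγ : -γ ∉ spectrum ℂ T)
    (hT : IsCompactOperator (T ∘L T - γ ^ 2 • ContinuousLinearMap.id ℂ H)) :
    IsCompactOperator (T - γ • ContinuousLinearMap.id ℂ H) := by
  obtain ⟨u, hu⟩ := spectrum.notMem_iff.1 hγ
  have h1 : T - γ • ContinuousLinearMap.id ℂ H =
      (T ∘L T - γ ^ 2 • ContinuousLinearMap.id ℂ H) ∘L (-(↑u⁻¹ : H →L[ℂ] H)) := by
    have h2 : T ∘L T - γ ^ 2 • ContinuousLinearMap.id ℂ H =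
        (T - γ • ContinuousLinearMap.id ℂ H) * (-(u : H →L[ℂ] H)) := by
      rw [hu]
      ext x
      simp [Algebra.algebraMap_eq_smul_one, pow_two, mul_smul]
      abel
    rw [h2]
    change _ = (T - γ • ContinuousLinearMap.id ℂ H) * (-(u : H →L[ℂ] H)) * (-(↑u⁻¹ : H →L[ℂ] H))
    simp [mul_assoc]
  rw [h1]
  exact hT.comp_clm _

variable [CompleteSpace H]

/-- The operators that are scalar modulo the compact operators form a closed set. -/
theorem isClosed_setOf_exists_isCompactOperator_sub_smul_id :
    IsClosed {A : H →L[ℂ] H | ∃ c : ℂ, IsCompactOperator (A - c • ContinuousLinearMap.id ℂ H)} := by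
  have hcl : IsClosed ((compactOperator (RingHom.id ℂ) H H ⊔
      ℂ ∙ ContinuousLinearMap.id ℂ H : Submodule ℂ (H →L[ℂ] H)) : Set (H →L[ℂ] H)) :=
    Submodule.isClosed_sup_finiteDimensional _ _ isClosed_setOfPred_isCompactOperator
  convert hcl using 1
  ext A
  simp only [Set.mem_ofPred_eq, SetLike.mem_coe, Submodule.mem_sup, Submodule.mem_span_singleton]
  constructor
  · rintro ⟨c, hc⟩
    exact ⟨A - c • ContinuousLinearMap.id ℂ H, hc, _, ⟨c, rfl⟩, by simp⟩
  · rintro ⟨B, hB, _, ⟨c, rfl⟩, rfl⟩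
    exact ⟨c, by rwa [add_sub_cancel_right]⟩

/-- A positive operator whose square is scalar modulo compacts is itself scalar modulo compacts:
factor `T² - γ² = (T - γ) (T + γ)` with the square root `γ` chosen so that `T + γ` is
invertible, unless `γ = 0`. -/
theorem exists_isCompactOperator_sub_of_adjoint_comp_self {T : H →L[ℂ] H} (hT : T.IsPositive)
    {c : ℂ} (hc : IsCompactOperator (adjoint T ∘L T - c • ContinuousLinearMap.id ℂ H)) :
    ∃ γ : ℂ, IsCompactOperator (T - γ • ContinuousLinearMap.id ℂ H) := by
  open scoped ComplexOrder in
  have hspec : ∀ z ∈ spectrum ℂ T, 0 ≤ z := fun z hz ↦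
    spectrum_nonneg_of_nonneg ((nonneg_iff_isPositive T).2 hT) hz
  obtain ⟨γ, rfl⟩ := IsAlgClosed.exists_pow_nat_eq c zero_lt_two
  by_cases h0 : γ = 0
  · subst h0
    refine ⟨0, ?_⟩
    simp only [zero_smul, sub_zero]
    exact isCompactOperator_of_adjoint_comp_self (by simpa using hc)
  rw [hT.isSelfAdjoint.adjoint_eq] at hc
  by_cases h1 : -γ ∈ spectrum ℂ T
  · refine ⟨-γ, isCompactOperator_sub_of_sq (fun h2 ↦ h0 ?_) (by simpa using hc)⟩
    open scoped ComplexOrder in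
    have h3 : 0 ≤ γ := by simpa using hspec _ h2
    open scoped ComplexOrder in
    have h4 : γ ≤ 0 := by simpa using hspec _ h1
    exact le_antisymm h4 h3
  · exact ⟨γ, isCompactOperator_sub_of_sq h1 hc⟩

/-- On an infinite-dimensional space, a positive operator is a norm limit of absolutely norm
attaining operators if and only if it is scalar modulo the compact operators. -/
theorem IsPositive.mem_closure_AN_iff (hH : ¬ FiniteDimensional ℂ H) {T : H →L[ℂ] H}
    (hT : T.IsPositive) :
    T ∈ closure (AN H H) ↔
      ∃ c : ℂ, IsCompactOperator (T - c • ContinuousLinearMap.id ℂ H) := by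
  refine ⟨fun h ↦ ?_, fun ⟨c, hc⟩ ↦ mem_closure_AN_of_isCompactOperator hc⟩
  have hcont : Continuous fun S : H →L[ℂ] H ↦ adjoint S ∘L S :=
    (adjoint (𝕜 := ℂ) (E := H) (F := H)).continuous.clm_comp continuous_id
  have h1 := map_mem_closure hcont h (t := {A : H →L[ℂ] H | ∃ c : ℂ,
      IsCompactOperator (A - c • ContinuousLinearMap.id ℂ H)}) (fun S hS ↦ by
    obtain ⟨c, hc⟩ :=
      AbsolutelyNormAttaining.exists_isCompactOperator_adjoint_comp_self_sub hH hS
    exact ⟨c, hc⟩)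
  rw [isClosed_setOf_exists_isCompactOperator_sub_smul_id.closure_eq] at h1
  obtain ⟨c, hc⟩ := h1
  exact exists_isCompactOperator_sub_of_adjoint_comp_self hT hc

end Characterization

/-! ### Block operators -/

section Block

variable {H₁ H₂ : Type*}
  [NormedAddCommGroup H₁] [InnerProductSpace ℂ H₁]
  [NormedAddCommGroup H₂] [InnerProductSpace ℂ H₂]

theorem blockOperator_sub_smul_id (A : H₁ →L[ℂ] H₁) (X : H₂ →L[ℂ] H₁) (Y : H₁ →L[ℂ] H₂)
    (B : H₂ →L[ℂ] H₂) (c : ℂ) :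
    blockOperator A X Y B - c • ContinuousLinearMap.id ℂ (WithLp 2 (H₁ × H₂)) =
      blockOperator (A - c • ContinuousLinearMap.id ℂ H₁) X Y
        (B - c • ContinuousLinearMap.id ℂ H₂) := by
  refine ContinuousLinearMap.ext fun z ↦ ?_
  refine (WithLp.prodContinuousLinearEquiv 2 ℂ H₁ H₂).injective (Prod.ext ?_ ?_) <;>
    simp [blockOperator] <;> abel

/-- A block operator is compact if and only if its entries are. -/
theorem isCompactOperator_blockOperator_iff {A : H₁ →L[ℂ] H₁} {X : H₂ →L[ℂ] H₁}
    {Y : H₁ →L[ℂ] H₂} {B : H₂ →L[ℂ] H₂} :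
    IsCompactOperator (blockOperator A X Y B) ↔
      IsCompactOperator A ∧ IsCompactOperator X ∧ IsCompactOperator Y ∧ IsCompactOperator B := by
  set e := WithLp.prodContinuousLinearEquiv 2 ℂ H₁ H₂
  set p₁ : WithLp 2 (H₁ × H₂) →L[ℂ] H₁ := fst ℂ H₁ H₂ ∘L e.toContinuousLinearMap
  set p₂ : WithLp 2 (H₁ × H₂) →L[ℂ] H₂ := snd ℂ H₁ H₂ ∘L e.toContinuousLinearMap
  set i₁ : H₁ →L[ℂ] WithLp 2 (H₁ × H₂) := e.symm.toContinuousLinearMap ∘L inl ℂ H₁ H₂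
  set i₂ : H₂ →L[ℂ] WithLp 2 (H₁ × H₂) := e.symm.toContinuousLinearMap ∘L inr ℂ H₁ H₂
  constructor
  · intro h
    refine ⟨?_, ?_, ?_, ?_⟩
    · have h1 : ⇑A = (p₁ ∘ blockOperator A X Y B) ∘ i₁ := by
        funext x
        simp [p₁, i₁, e, blockOperator]
      rw [h1]
      exact (h.clm_comp p₁).comp_clm i₁
    · have h1 : ⇑X = (p₁ ∘ blockOperator A X Y B) ∘ i₂ := by
        funext x
        simp [p₁, i₂, e, blockOperator]
      rw [h1]
      exact (h.clm_comp p₁).comp_clm i₂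
    · have h1 : ⇑Y = (p₂ ∘ blockOperator A X Y B) ∘ i₁ := by
        funext x
        simp [p₂, i₁, e, blockOperator]
      rw [h1]
      exact (h.clm_comp p₂).comp_clm i₁
    · have h1 : ⇑B = (p₂ ∘ blockOperator A X Y B) ∘ i₂ := by
        funext x
        simp [p₂, i₂, e, blockOperator]
      rw [h1]
      exact (h.clm_comp p₂).comp_clm i₂
  · rintro ⟨hA, hX, hY, hB⟩
    have h1 := ((hA.comp_clm p₁).add (hX.comp_clm p₂)).clm_comp i₁
    have h2 := ((hY.comp_clm p₁).add (hB.comp_clm p₂)).clm_comp i₂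
    have h3 : ⇑(blockOperator A X Y B) =
        i₁ ∘ (A ∘ p₁ + X ∘ p₂) + i₂ ∘ (Y ∘ p₁ + B ∘ p₂) := by
      funext z
      refine e.injective (Prod.ext ?_ ?_) <;> simp [p₁, p₂, i₁, i₂, e, blockOperator]
    rw [h3]
    exact h1.add h2

end Block

end AbsNorm

theorem mainTheorem1 {H₁ H₂ : Type*}
    [NormedAddCommGroup H₁] [InnerProductSpace ℂ H₁] [CompleteSpace H₁]
    [TopologicalSpace.SeparableSpace H₁]
    [NormedAddCommGroup H₂] [InnerProductSpace ℂ H₂] [CompleteSpace H₂]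
    [TopologicalSpace.SeparableSpace H₂]
    (hH₁ : ¬ FiniteDimensional ℂ H₁) (hH₂ : ¬ FiniteDimensional ℂ H₂)
    (A₁ : H₁ →L[ℂ] H₁) (A₂ : H₂ →L[ℂ] H₂) (X : H₂ →L[ℂ] H₁)
    (hA₁ : A₁.IsPositive) (hA₂ : A₂.IsPositive)
    (hT : (AbsNorm.blockOperator A₁ X (ContinuousLinearMap.adjoint X) A₂).IsPositive) :
    AbsNorm.blockOperator A₁ X (ContinuousLinearMap.adjoint X) A₂ ∈
        closure (AbsNorm.AN (WithLp 2 (H₁ × H₂)) (WithLp 2 (H₁ × H₂))) ↔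
      A₁ ∈ closure (AbsNorm.AN H₁ H₁) ∧ A₂ ∈ closure (AbsNorm.AN H₂ H₂) ∧
        AbsNorm.essentialSpectrum A₁ = AbsNorm.essentialSpectrum A₂ ∧
        IsCompactOperator X := by
  have hH : ¬ FiniteDimensional ℂ (WithLp 2 (H₁ × H₂)) := fun h ↦ hH₁ <|
    Module.Finite.of_surjective
      (LinearMap.fst ℂ H₁ H₂ ∘ₗ (WithLp.linearEquiv 2 ℂ (H₁ × H₂)).toLinearMap)
      (Prod.fst_surjective.comp (WithLp.linearEquiv 2 ℂ (H₁ × H₂)).surjective)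
  rw [AbsNorm.IsPositive.mem_closure_AN_iff hH hT, AbsNorm.IsPositive.mem_closure_AN_iff hH₁ hA₁,
    AbsNorm.IsPositive.mem_closure_AN_iff hH₂ hA₂]
  simp only [AbsNorm.blockOperator_sub_smul_id, AbsNorm.isCompactOperator_blockOperator_iff]
  constructor
  · rintro ⟨c, h₁, hX, -, h₂⟩
    refine ⟨⟨c, h₁⟩, ⟨c, h₂⟩, ?_, hX⟩
    rw [AbsNorm.essentialSpectrum_eq_singleton hH₁ h₁,
      AbsNorm.essentialSpectrum_eq_singleton hH₂ h₂]
  · rintro ⟨⟨c, h₁⟩, ⟨d, h₂⟩, hess, hX⟩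
    rw [AbsNorm.essentialSpectrum_eq_singleton hH₁ h₁,
      AbsNorm.essentialSpectrum_eq_singleton hH₂ h₂, Set.singleton_eq_singleton_iff] at hess
    subst hess
    exact ⟨c, h₁, hX, AbsNorm.isCompactOperator_adjoint hX, h₂⟩
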